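/- Let $\mathbb{H}$ be the real quaternion division ring, with $\mathbb{R}\subset\mathbb{H}$ its center, and let $\mathbb{R}\langle\mathcal{X}\rangle$ be the free associative unital $\mathbb{R}$-algebra on countably many noncommuting variables. For $p\in\mathbb{R}\langle\mathcal{X}\rangle$ and a unital associative $\mathbb{R}$-algebra $\mathcal{A}$, let $p(\mathcal{A})\subseteq\mathcal{A}$ denote the set of all values of $p$ under substitutions of elements of $\mathcal{A}$ for the variables. Call $p$ multilinear if there are an integer $m\ge 1$, distinct variables $y_1,\dots,y_m\in\mathcal{X}$ and real numbers $\lambda_\sigma$ ($\sigma\in S_m$) with $p=\sum_{\sigma\in S_m}\lambda_\sigma\, y_{\sigma(1)}y_{\sigma(2)}\cdots y_{\sigma(m)}$. Let $\mathrm{GL}_n(\mathbb{H})$ be the group of invertible matrices in $\mathrm{M}_n(\mathbb{H})$, and let $\mathrm{SL}_n(\mathbb{H})$ be the subgroup of $\mathrm{GL}_n(\mathbb{H})$ generated by all multiplicative commutators $xyx^{-1}y^{-1}$ with $x,y\in\mathrm{GL}_n(\mathbb{H})$. **Theorem.** Let $n\ge 2$ be an integer. (i) Let $p_1,\dots,p_4\in\mathbb{R}\langle\mathcal{X}\rangle$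 be multilinear polynomials with $p_i(\mathbb{H})\ne\{0\}$ and $p_i(\mathbb{H})\ne\mathbb{R}$ for each $i$. Then for every $B\in\mathrm{SL}_n(\mathbb{H})$ there are invertible matrices $A_i\in p_i(\mathrm{M}_n(\mathbb{H}))$, $i=1,\dots,4$, such that $$B=A_1A_2A_1^{-1}A_2^{-1}\,A_3A_4A_3^{-1}A_4^{-1}.$$ (ii) Let $p_1,\dots,p_8\in\mathbb{R}\langle\mathcal{X}\rangle$ be multilinear polynomials with $p_i(\mathbb{H})\ne\{0\}$ and $p_i(\mathbb{H})\ne\mathbb{R}$ for each $i$. Then for every matrix $B\in\mathrm{M}_n(\mathbb{H})$ there are invertible matrices $A_i\in p_i(\mathrm{M}_n(\mathbb{H}))$, $i=1,\dots,8$, such that $$B=A_1A_2A_1^{-1}A_2^{-1}\,A_3A_4A_3^{-1}A_4^{-1}-A_5A_6A_5^{-1}A_6^{-1}\,A_7A_8A_7^{-1}A_8^{-1}.$$ -/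

import Mathlib

open scoped Quaternion

noncomputable section

/-- The image `p(𝒜)` of a noncommutative polynomial `p ∈ ℝ⟨x₀, x₁, x₂, …⟩` on a unital associative
real algebra `𝒜`: the set of all values of `p` under substitutions of elements of `𝒜` for the
variables. -/
def polyImage (p : FreeAlgebra ℝ ℕ) (𝒜 : Type*) [Ring 𝒜] [Algebra ℝ 𝒜] : Set 𝒜 :=
  Set.range fun a : ℕ → 𝒜 => FreeAlgebra.lift ℝ a p

/-- `p` is multilinear: for some `m ≥ 1` and some `m` distinct variables `y₁, …, yₘ` it is of the
form `∑_{σ ∈ Sₘ} c_σ y_{σ(1)} y_{σ(2)} ⋯ y_{σ(m)}` with real coefficients `c_σ`. -/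
def IsMultilinearPoly (p : FreeAlgebra ℝ ℕ) : Prop :=
  ∃ (m : ℕ) (v : Fin m → ℕ) (c : Equiv.Perm (Fin m) → ℝ), 0 < m ∧ Function.Injective v ∧
    p = ∑ σ : Equiv.Perm (Fin m),
      c σ • (List.ofFn fun i : Fin m => FreeAlgebra.ι ℝ (v (σ i))).prod

/-- The general linear group `GLₙ(ℍ)` over the real quaternions: the unit group of `Mₙ(ℍ)`. -/
abbrev QuatGL (n : ℕ) : Type := (Matrix (Fin n) (Fin n) ℍ[ℝ])ˣ

/-- The special linear group `SLₙ(ℍ)` over the real quaternions: the subgroup of `GLₙ(ℍ)`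
generated by all multiplicative commutators `x y x⁻¹ y⁻¹`. -/
def QuatSL (n : ℕ) : Subgroup (QuatGL n) := commutator (QuatGL n)

end

open scoped Quaternion

/-! The polynomials enter only through one fact: each `p i` takes every pure quaternion as a value
on `ℍ`. Indeed `ℍ` is graded by the Klein four-group with one-dimensional components, so a
multilinear polynomial sends basis units to real multiples of basis units. If all those values were
real, the image would be `{0}` or `ℝ`; otherwise scaling and conjugation reach all pure quaternions.
Hence every matrix similar to a pure diagonal one is a value on matrices
(`IsPureDiagonalizable.mem_polyImage`).

The rest is matrix theory. A unit quaternion is a commutator of pure ones; a triangular Sylvester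
equation lifts this to triangular matrices with unit-norm diagonal
(`BlockTriangular.exists_commutator`). A matrix whose real determinant has absolute value 1 is
similar to a product of two such triangular matrices (`hasUnitLU_of_abs_realDet`), hence is a
product of two commutators. This gives (i), as `realDet` is 1 on commutators, and (ii), as every
matrix is a difference of two of this kind (`exists_realDet_eq_one_add`). -/

/-! ### Images of polynomials -/

theorem map_mem_polyImage {p : FreeAlgebra ℝ ℕ} {A B : Type*} [Ring A] [Algebra ℝ A] [Ring B]
    [Algebra ℝ B] (f : A →ₐ[ℝ] B) {x : A} (hx : x ∈ polyImage p A) : f x ∈ polyImage p B := by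
  obtain ⟨a, rfl⟩ := hx
  refine ⟨fun k => f (a k), ?_⟩
  have : FreeAlgebra.lift ℝ (fun k => f (a k)) = f.comp (FreeAlgebra.lift ℝ a) := by
    ext k; simp
  simp [this]

theorem conj_mem_polyImage {p : FreeAlgebra ℝ ℕ} {A : Type*} [Ring A] [Algebra ℝ A]
    (u : Aˣ) {x : A} (hx : x ∈ polyImage p A) : (u * x * ↑u⁻¹ : A) ∈ polyImage p A := by
  let f : A →ₐ[ℝ] A := AlgHom.ofLinearMap
    ((LinearMap.mulRight ℝ (↑u⁻¹ : A)).comp (LinearMap.mulLeft ℝ (u : A)))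
    (by simp) (by intro x y; simp [mul_assoc])
  exact map_mem_polyImage f hx

theorem pi_mem_polyImage {p : FreeAlgebra ℝ ℕ} {A ι : Type*} [Ring A] [Algebra ℝ A] {d : ι → A}
    (hd : ∀ i, d i ∈ polyImage p A) : d ∈ polyImage p (ι → A) := by
  choose a ha using hd
  refine ⟨fun k i => a i k, ?_⟩
  funext i
  have : (Pi.evalAlgHom ℝ (fun _ : ι => A) i).comp (FreeAlgebra.lift ℝ fun k i => a i k) =
      FreeAlgebra.lift ℝ (a i) := by
    ext k; simp
  exact (congrArg (fun f => f p) this).trans (ha i)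

theorem diagonal_mem_polyImage {p : FreeAlgebra ℝ ℕ} {A ι : Type*} [Fintype ι] [DecidableEq ι]
    [Ring A] [Algebra ℝ A] {d : ι → A} (hd : ∀ i, d i ∈ polyImage p A) :
    Matrix.diagonal d ∈ polyImage p (Matrix ι ι A) :=
  map_mem_polyImage (Matrix.diagonalAlgHom ℝ) (pi_mem_polyImage hd)

theorem IsMultilinearPoly.exists_multilinearMap {p : FreeAlgebra ℝ ℕ} (hp : IsMultilinearPoly p)
    (A : Type*) [Ring A] [Algebra ℝ A] :
    ∃ (m : ℕ) (c : Equiv.Perm (Fin m) → ℝ) (F : MultilinearMap ℝ (fun _ : Fin m => A) A), 0 < m ∧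
      (∀ x, F x = ∑ σ : Equiv.Perm (Fin m), c σ • (List.ofFn fun i => x (σ i)).prod) ∧
      polyImage p A = Set.range F := by
  obtain ⟨m, v, c, hm, hv, rfl⟩ := hp
  let F : MultilinearMap ℝ (fun _ : Fin m => A) A :=
    ∑ σ : Equiv.Perm (Fin m), c σ • (MultilinearMap.mkPiAlgebraFin ℝ m A).domDomCongr σ
  have hF : ∀ x, F x = ∑ σ : Equiv.Perm (Fin m), c σ • (List.ofFn fun i => x (σ i)).prod := by
    intro x
    simp [F]
  have hl : ∀ a : ℕ → A, FreeAlgebra.lift ℝ a (∑ σ : Equiv.Perm (Fin m),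
      c σ • (List.ofFn fun i : Fin m => FreeAlgebra.ι ℝ (v (σ i))).prod) = F (a ∘ v) := by
    intro a
    simp only [hF, map_sum, map_smul, map_list_prod, List.map_ofFn]
    refine Finset.sum_congr rfl fun σ _ => ?_
    congr 3
    funext i
    simp
  refine ⟨m, c, F, hm, hF, ?_⟩
  ext y
  constructor
  · rintro ⟨a, rfl⟩
    exact ⟨a ∘ v, (hl a).symm⟩
  · rintro ⟨x, rfl⟩
    -- Distinctness of the variables allows arbitrary arguments; variables outside `v` get the value
    -- 0.
    refine ⟨Function.extend v x 0, ?_⟩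
    simp only [hl]
    congr 1
    funext i
    exact hv.extend_apply x 0 i

theorem IsMultilinearPoly.smul_mem_polyImage {p : FreeAlgebra ℝ ℕ} (hp : IsMultilinearPoly p)
    {A : Type*} [Ring A] [Algebra ℝ A] (r : ℝ) {x : A} (hx : x ∈ polyImage p A) :
    r • x ∈ polyImage p A := by
  obtain ⟨m, c, F, hm, -, h⟩ := hp.exists_multilinearMap A
  rw [h] at hx ⊢
  obtain ⟨y, rfl⟩ := hx
  refine ⟨Function.update y ⟨0, hm⟩ (r • y ⟨0, hm⟩), ?_⟩
  rw [F.map_update_smul, Function.update_eq_self]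

/-! ### The Klein four-grading of the quaternions -/

namespace Quaternion

/-- The standard basis `1, i, j, k` of the quaternions, indexed by the Klein four-group. -/
def unitOf (g : ZMod 2 × ZMod 2) : ℍ[ℝ] :=
  ⟨if g = (0, 0) then 1 else 0, if g = (1, 0) then 1 else 0, if g = (0, 1) then 1 else 0,
    if g = (1, 1) then 1 else 0⟩

theorem re_unitOf (g : ZMod 2 × ZMod 2) : (unitOf g).re = if g = (0, 0) then 1 else 0 := rfl

theorem imI_unitOf (g : ZMod 2 × ZMod 2) : (unitOf g).imI = if g = (1, 0) then 1 else 0 := rfl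

theorem imJ_unitOf (g : ZMod 2 × ZMod 2) : (unitOf g).imJ = if g = (0, 1) then 1 else 0 := rfl

theorem imK_unitOf (g : ZMod 2 × ZMod 2) : (unitOf g).imK = if g = (1, 1) then 1 else 0 := rfl

theorem zmod_two_prod_cases (g : ZMod 2 × ZMod 2) :
    g = (0, 0) ∨ g = (1, 0) ∨ g = (0, 1) ∨ g = (1, 1) := by
  revert g; decide

theorem unitOf_zero : unitOf 0 = 1 := by
  ext <;> simp [re_unitOf, imI_unitOf, imJ_unitOf, imK_unitOf, Prod.ext_iff]

theorem exists_unitOf_mul (g h : ZMod 2 × ZMod 2) :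
    ∃ r : ℝ, unitOf g * unitOf h = r • unitOf (g + h) := by
  obtain ⟨r, hr⟩ : ∃ r : ℝ, (r = 1 ∨ r = -1) ∧ unitOf g * unitOf h = r • unitOf (g + h) := by
    have h2 : (1 : ZMod 2) + 1 = 0 := rfl
    rcases zmod_two_prod_cases g with rfl | rfl | rfl | rfl <;>
    rcases zmod_two_prod_cases h with rfl | rfl | rfl | rfl <;>
    first
    | (refine ⟨1, Or.inl rfl, ?_⟩
       ext <;> simp [re_unitOf, imI_unitOf, imJ_unitOf, imK_unitOf, h2]; done)
    | (refine ⟨-1, Or.inr rfl, ?_⟩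
       ext <;> simp [re_unitOf, imI_unitOf, imJ_unitOf, imK_unitOf, h2])
  exact ⟨r, hr.2⟩

theorem exists_prod_unitOf {m : ℕ} (g : Fin m → ZMod 2 × ZMod 2) :
    ∃ r : ℝ, (List.ofFn fun i => unitOf (g i)).prod = r • unitOf (∑ i, g i) := by
  induction m with
  | zero => exact ⟨1, by simp [unitOf_zero]⟩
  | succ m ih =>
    obtain ⟨r, hr⟩ := ih fun i => g i.succ
    obtain ⟨s, hs⟩ := exists_unitOf_mul (g 0) (∑ i : Fin m, g i.succ)
    refine ⟨r * s, ?_⟩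
    rw [List.ofFn_succ, List.prod_cons, hr, mul_smul_comm, hs, Fin.sum_univ_succ, smul_smul]

theorem span_range_unitOf : ⊤ ≤ Submodule.span ℝ (Set.range unitOf) := by
  rintro q -
  have : q = q.re • unitOf (0, 0) + q.imI • unitOf (1, 0) + q.imJ • unitOf (0, 1) +
      q.imK • unitOf (1, 1) := by
    ext <;> simp [re_unitOf, imI_unitOf, imJ_unitOf, imK_unitOf]
  rw [this]
  have h : ∀ (r : ℝ) g, r • unitOf g ∈ Submodule.span ℝ (Set.range unitOf) := fun r g =>
    Submodule.smul_mem _ _ (Submodule.subset_span ⟨g, rfl⟩)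
  exact add_mem (add_mem (add_mem (h _ _) (h _ _)) (h _ _)) (h _ _)

/-- The basis `1, i, j, k` of the quaternions, indexed by the Klein four-group. -/
noncomputable def unitBasis : Module.Basis (ZMod 2 × ZMod 2) ℝ ℍ[ℝ] :=
  basisOfTopLeSpanOfCardEqFinrank unitOf span_range_unitOf
    (by rw [Quaternion.finrank_eq_four]; rfl)

/-- Two quaternions with square `-1`, one of them noncentral, are conjugate. -/
theorem exists_conj_of_sq_eq_neg_one {x y : ℍ[ℝ]} (hx : x * x = -1) (hy : y * y = -1)
    (hc : ∃ h : ℍ[ℝ], y * h ≠ h * y) : ∃ g : ℍ[ℝ], g ≠ 0 ∧ x * g = g * y := by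
  -- Each `h - x * h * y` intertwines `x` and `y`. If all of them vanish, `h = 1` forces `x = -y`,
  -- and then `y` is central.
  have key : ∀ h : ℍ[ℝ], x * (h - x * h * y) = (h - x * h * y) * y := by
    intro h
    have h1 : x * (x * h * y) = -(h * y) := by
      rw [show x * (x * h * y) = x * x * (h * y) by noncomm_ring, hx]; simp
    have h2 : x * h * y * y = -(x * h) := by
      rw [mul_assoc, hy]; simp
    rw [mul_sub, sub_mul, h1, h2]
    noncomm_ring
  by_contra! hg
  have h0 : ∀ h : ℍ[ℝ], h = x * h * y := by
    intro h
    by_contra hne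
    exact hg _ (sub_ne_zero.mpr hne) (key h)
  obtain ⟨h, hh⟩ := hc
  have h1 : x * y = 1 := by simpa using (h0 1).symm
  have hxy : x = -y := by
    have : x * y * y = y := by rw [h1, one_mul]
    rw [mul_assoc, hy] at this
    rw [← this]; simp
  apply hh
  have h3 := h0 h
  rw [hxy] at h3
  calc y * h = y * (-y * h * y) := by rw [← h3]
    _ = -(y * y) * (h * y) := by noncomm_ring
    _ = h * y := by rw [hy]; simp

theorem mul_self_of_re_eq_zero {q : ℍ[ℝ]} (hq : q.re = 0) :
    q * q = -algebraMap ℝ ℍ[ℝ] (‖q‖ * ‖q‖) := by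
  have h : star q = -q := by ext <;> simp [hq]
  have h2 := Quaternion.self_mul_star q
  rw [h, Quaternion.normSq_eq_norm_mul_self, mul_neg] at h2
  rw [← neg_eq_iff_eq_neg]
  exact h2

theorem unitOf_mul_self {g : ZMod 2 × ZMod 2} (hg : g ≠ 0) :
    unitOf g * unitOf g = -1 := by
  rcases zmod_two_prod_cases g with rfl | rfl | rfl | rfl <;>
    first | exact absurd rfl hg | (ext <;> simp [re_unitOf, imI_unitOf, imJ_unitOf, imK_unitOf])

theorem exists_unitOf_mul_ne {g : ZMod 2 × ZMod 2} (hg : g ≠ 0) :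
    ∃ h : ℍ[ℝ], unitOf g * h ≠ h * unitOf g := by
  refine ⟨unitOf (1, 0) + unitOf (0, 1), fun H => ?_⟩
  rw [Quaternion.ext_iff] at H
  rcases zmod_two_prod_cases g with rfl | rfl | rfl | rfl
  · exact hg rfl
  all_goals
    simp [re_unitOf, imI_unitOf, imJ_unitOf, imK_unitOf] at H
    norm_num at H

end Quaternion

/-! ### Pure quaternions as values of multilinear polynomials -/

open Quaternion in
theorem IsMultilinearPoly.exists_unitOf_mem {p : FreeAlgebra ℝ ℕ} (hp : IsMultilinearPoly p)
    (h0 : polyImage p ℍ[ℝ] ≠ {0}) (hR : polyImage p ℍ[ℝ] ≠ Set.range (algebraMap ℝ ℍ[ℝ])) :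
    ∃ g ≠ 0, unitOf g ∈ polyImage p ℍ[ℝ] := by
  obtain ⟨m, c, F, hm, hF, hr⟩ := hp.exists_multilinearMap ℍ[ℝ]
  have hval : ∀ g : Fin m → ZMod 2 × ZMod 2, ∃ r : ℝ, F (fun i => unitOf (g i)) =
      r • unitOf (∑ i, g i) := by
    intro g
    -- The degree group is commutative, so all monomials have the same degree.
    have h1 : ∀ σ : Equiv.Perm (Fin m), ∃ r : ℝ,
        (List.ofFn fun i => unitOf (g (σ i))).prod = r • unitOf (∑ i, g i) := by
      intro σ
      obtain ⟨r, h⟩ := exists_prod_unitOf fun i => g (σ i)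
      exact ⟨r, by rw [h, Equiv.sum_comp σ g]⟩
    choose r h using h1
    refine ⟨∑ σ, c σ * r σ, ?_⟩
    simp only [hF, h, smul_smul, Finset.sum_smul]
  by_contra! hne
  have him : ∀ g : Fin m → ZMod 2 × ZMod 2, (F fun i => unitOf (g i)) ∈
      Set.range (algebraMap ℝ ℍ[ℝ]) := by
    intro g
    obtain ⟨r, h⟩ := hval g
    by_cases hg : ∑ i, g i = 0
    · exact ⟨r, by rw [h, hg, Algebra.algebraMap_eq_smul_one, unitOf_zero]⟩
    · by_cases hr0 : r = 0
      · exact ⟨0, by simp [h, hr0]⟩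
      · refine absurd ?_ (hne _ hg)
        have := hp.smul_mem_polyImage r⁻¹ (hr ▸ ⟨_, h⟩ : r • unitOf (∑ i, g i) ∈ polyImage p ℍ[ℝ])
        rwa [smul_smul, inv_mul_cancel₀ hr0, one_smul] at this
  -- Modulo the real line the multilinear map vanishes on basis tuples, hence everywhere.
  let N : Submodule ℝ ℍ[ℝ] := LinearMap.range (Algebra.linearMap ℝ ℍ[ℝ])
  have hz : N.mkQ.compMultilinearMap F = 0 := by
    refine Module.Basis.ext_multilinear (fun _ => unitBasis) fun g => ?_
    have := him g
    simp only [unitBasis, coe_basisOfTopLeSpanOfCardEqFinrank, LinearMap.compMultilinearMap_apply,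
      zero_apply, Submodule.mkQ_apply, Submodule.Quotient.mk_eq_zero]
    exact this
  have hsub : polyImage p ℍ[ℝ] ⊆ Set.range (algebraMap ℝ ℍ[ℝ]) := by
    rw [hr]
    rintro _ ⟨x, rfl⟩
    have := congrArg (fun G => G x) hz
    simp only [LinearMap.compMultilinearMap_apply, zero_apply, Submodule.mkQ_apply,
      Submodule.Quotient.mk_eq_zero] at this
    exact this
  have hne0 : (polyImage p ℍ[ℝ]).Nonempty := hr ▸ Set.range_nonempty F
  obtain ⟨x, hx, hx0⟩ : ∃ x ∈ polyImage p ℍ[ℝ], x ≠ 0 := by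
    by_contra! H
    exact h0 (Set.eq_singleton_iff_nonempty_unique_mem.mpr ⟨hne0, H⟩)
  refine hR (hsub.antisymm ?_)
  rintro _ ⟨s, rfl⟩
  obtain ⟨r, rfl⟩ := hsub hx
  have hr0 : r ≠ 0 := by rintro rfl; simp at hx0
  have := hp.smul_mem_polyImage (s / r) hx
  rwa [Algebra.algebraMap_eq_smul_one, smul_smul, div_mul_cancel₀ _ hr0,
    ← Algebra.algebraMap_eq_smul_one] at this

open Quaternion in
-- A nonzero pure quaternion is its norm times a square root of -1, and such roots are all conjugate
-- to the basis unit already found.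
theorem IsMultilinearPoly.mem_polyImage_of_re_eq_zero {p : FreeAlgebra ℝ ℕ}
    (hp : IsMultilinearPoly p) (h0 : polyImage p ℍ[ℝ] ≠ {0})
    (hR : polyImage p ℍ[ℝ] ≠ Set.range (algebraMap ℝ ℍ[ℝ])) {q : ℍ[ℝ]} (hq : q.re = 0) :
    q ∈ polyImage p ℍ[ℝ] := by
  obtain ⟨e, he, hmem⟩ := hp.exists_unitOf_mem h0 hR
  by_cases hq0 : q = 0
  · simpa [hq0] using hp.smul_mem_polyImage 0 hmem
  have hn : ‖q‖ ≠ 0 := norm_ne_zero_iff.mpr hq0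
  have hsq : (‖q‖⁻¹ • q) * (‖q‖⁻¹ • q) = -1 := by
    rw [smul_mul_smul_comm, mul_self_of_re_eq_zero hq, Algebra.algebraMap_eq_smul_one, smul_neg,
      smul_smul]
    field_simp
    simp
  obtain ⟨g, hg0, hg⟩ := exists_conj_of_sq_eq_neg_one hsq (unitOf_mul_self he)
    (exists_unitOf_mul_ne he)
  have h1 := hp.smul_mem_polyImage ‖q‖ (conj_mem_polyImage (Units.mk0 g hg0) hmem)
  rw [Units.val_mk0, ← hg, ← Units.mk0_val (Units.mk0 g hg0)⁻¹ (Units.ne_zero _)] at h1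
  simpa [mul_assoc, hg0, smul_smul, hn] using h1

/-! ### Unit quaternions as commutators of pure ones -/

namespace Quaternion

theorem mul_star_self_of_norm_one {q : ℍ[ℝ]} (hq : ‖q‖ = 1) : star q * q = 1 := by
  rw [Quaternion.star_mul_self, Quaternion.normSq_eq_norm_mul_self, hq]; simp

/-- Away from `u = -1` the root is `1 + u` normalised, because `u * star (1 + u) = 1 + u`. -/
theorem exists_mul_self_eq {u : ℍ[ℝ]} (hu : ‖u‖ = 1) : ∃ w : ℍ[ℝ], ‖w‖ = 1 ∧ w * w = u := by
  by_cases h : u = -1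
  · refine ⟨unitOf (1, 0), ?_, ?_⟩
    · have := congrArg norm (unitOf_mul_self (g := (1, 0)) (by decide))
      rw [norm_mul, norm_neg, norm_one] at this
      nlinarith [norm_nonneg (unitOf (1, 0))]
    · rw [h, unitOf_mul_self (by decide)]
  · have h1 : 1 + u ≠ 0 := fun H => h (eq_neg_of_add_eq_zero_right H)
    have hn : ‖1 + u‖ ≠ 0 := norm_ne_zero_iff.mpr h1
    have hs : star (1 + u) * (1 + u) = algebraMap ℝ ℍ[ℝ] (‖1 + u‖ * ‖1 + u‖) := by
      rw [Quaternion.star_mul_self, Quaternion.normSq_eq_norm_mul_self]; rfl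
    have hsu : u * star (1 + u) = 1 + u := by
      have := mul_star_self_of_norm_one (q := star u) (by simpa using hu)
      rw [star_star] at this
      rw [star_add, star_one, mul_add, this, mul_one, add_comm]
    refine ⟨‖1 + u‖⁻¹ • (1 + u), by rw [norm_smul, norm_inv, norm_norm, inv_mul_cancel₀ hn], ?_⟩
    rw [smul_mul_smul_comm]
    nth_rw 3 [← hsu]
    rw [mul_assoc, hs, Algebra.algebraMap_eq_smul_one, mul_smul_comm, smul_smul, mul_one]
    field_simp
    simp

/-- Every quaternion is orthogonal to some pure unit quaternion. -/
theorem exists_pure_orthogonal (w : ℍ[ℝ]) : ∃ x : ℍ[ℝ], x.re = 0 ∧ ‖x‖ = 1 ∧ (x * w).re = 0 := by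
  obtain ⟨x, h0, h1, h2⟩ : ∃ x : ℍ[ℝ], x ≠ 0 ∧ x.re = 0 ∧ (x * w).re = 0 := by
    by_cases h : w.imI = 0
    · refine ⟨unitOf (1, 0), fun H => ?_, ?_, ?_⟩
      · have := congrArg QuaternionAlgebra.imI H
        simp [imI_unitOf] at this
      all_goals simp [re_unitOf, imI_unitOf, imJ_unitOf, imK_unitOf, h]
    · refine ⟨w.imJ • unitOf (1, 0) - w.imI • unitOf (0, 1), fun H => ?_, ?_, ?_⟩
      · have := congrArg QuaternionAlgebra.imJ H
        simp [imJ_unitOf] at this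
        exact h this
      all_goals simp [re_unitOf, imI_unitOf, imJ_unitOf, imK_unitOf]
      ring
  refine ⟨‖x‖⁻¹ • x, by simp [h1], by simp [norm_smul, h0], ?_⟩
  rw [smul_mul_assoc, Quaternion.re_smul, h2, smul_zero]

/-- Every unit quaternion is a multiplicative commutator of pure unit quaternions. -/
theorem exists_pure_commutator {u : ℍ[ℝ]} (hu : ‖u‖ = 1) :
    ∃ x y : ℍ[ℝ], x.re = 0 ∧ y.re = 0 ∧ ‖x‖ = 1 ∧ ‖y‖ = 1 ∧ x * y = u * (y * x) := by
  -- With `y = -(x * w)` pure, `x⁻¹ = -x` and `y⁻¹ = -y`, so the commutator is `(x * y)² = w²`.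
  obtain ⟨w, hw, rfl⟩ := exists_mul_self_eq hu
  obtain ⟨x, hx0, hx, hxw⟩ := exists_pure_orthogonal w
  have hxx : x * x = -1 := by rw [mul_self_of_re_eq_zero hx0, hx]; simp
  have hy0 : (-(x * w)).re = 0 := by simp only [Quaternion.re_neg, hxw, neg_zero]
  have hyn : ‖-(x * w)‖ = 1 := by rw [norm_neg, norm_mul, hx, hw, one_mul]
  have hyy : (-(x * w)) * (-(x * w)) = -1 := by
    rw [mul_self_of_re_eq_zero hy0, hyn]; simp
  have hxy : x * -(x * w) = w := by rw [mul_neg, ← mul_assoc, hxx]; simp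
  refine ⟨x, -(x * w), hx0, hy0, hx, hyn, ?_⟩
  generalize -(x * w) = y at *
  rw [← hxy, show x * y * (x * y) * (y * x) = x * y * x * (y * y) * x by noncomm_ring, hyy]
  rw [show x * y * x * -1 * x = -(x * y * (x * x)) by noncomm_ring, hxx]
  simp

end Quaternion

/-! ### Triangular Sylvester equations -/

namespace Matrix

section Sylvester

variable {ι α : Type*} [Fintype ι] [LinearOrder α] {b : ι → α}
  {A M : Matrix ι ι ℍ[ℝ]} {d : ι → ℍ[ℝ]}

theorem BlockTriangular.mul_apply_of_forall_eq_zero (hb : b.Injective) (hA : A.BlockTriangular b)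
    {X : Matrix ι ι ℍ[ℝ]} {i j : ι} (h : ∀ k, b i < b k → X k j = 0) :
    (A * X) i j = A i i * X i j := by
  rw [Matrix.mul_apply]
  refine Finset.sum_eq_single i (fun k _ hk => ?_) (by simp)
  rcases lt_or_gt_of_ne (hb.ne hk) with h1 | h1
  · rw [hA h1, zero_mul]
  · rw [h k h1, mul_zero]

variable [DecidableEq ι]

/-- At the last nonzero entry `X k j` of column `j` the equation collapses to `A k k * X k j = M k k
* X k j * d j`, which the norms exclude unless `k = j`. -/
theorem BlockTriangular.le_of_sylvester (hb : b.Injective) (hA : A.BlockTriangular b)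
    (hM : M.BlockTriangular b) (hd : ∀ i j, i ≠ j → ‖A i i‖ ≠ ‖M i i‖ * ‖d j‖)
    {X : Matrix ι ι ℍ[ℝ]}
    (hX : ∀ i j, i ≠ j → (A * X) i j = (M * X * diagonal d) i j) {i j : ι} (hij : X i j ≠ 0) :
    b i ≤ b j ∧ X j j ≠ 0 := by
  classical
  obtain ⟨k, hk, hmax⟩ := Finset.exists_max_image (Finset.univ.filter fun k => X k j ≠ 0) b
    ⟨i, by simpa using hij⟩
  simp only [Finset.mem_filter, Finset.mem_univ, true_and] at hk hmax
  have hz : ∀ l, b k < b l → X l j = 0 := fun l hl => by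
    by_contra hne
    exact absurd (hmax l hne) (not_le.mpr hl)
  have hkj : k = j := by
    by_contra hne
    have h1 := hX k j hne
    rw [mul_diagonal, hA.mul_apply_of_forall_eq_zero hb hz,
      hM.mul_apply_of_forall_eq_zero hb hz] at h1
    have h2 := congrArg norm h1
    rw [norm_mul, norm_mul, norm_mul] at h2
    refine hd k j hne (mul_right_cancel₀ (norm_ne_zero_iff.mpr hk) ?_)
    rw [h2]; ring
  subst hkj
  exact ⟨hmax i hij, hk⟩

/-- A triangular Sylvester equation `A X = M X D` over the quaternions. -/
theorem BlockTriangular.exists_sylvester (hb : b.Injective) (hA : A.BlockTriangular b)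
    (hM : M.BlockTriangular b) (hd : ∀ i j, i ≠ j → ‖A i i‖ ≠ ‖M i i‖ * ‖d j‖) (c : ι → ℍ[ℝ])
    (hc : ∀ i, A i i * c i = M i i * c i * d i) :
    ∃ X : Matrix ι ι ℍ[ℝ], X.BlockTriangular b ∧ (∀ i, X i i = c i) ∧
      A * X = M * X * diagonal d := by
  -- `G` records the diagonal of `X` and the off-diagonal residual of the equation. It is injective,
  -- so by finite dimension some `X` has diagonal `c` and zero residual.
  let G : Matrix ι ι ℍ[ℝ] →ₗ[ℝ] Matrix ι ι ℍ[ℝ] :=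
    { toFun := fun X => of fun i j => if i = j then X i j else (A * X - M * X * diagonal d) i j
      map_add' := by
        intro X Y
        refine Matrix.ext fun i j => ?_
        simp only [of_apply, Matrix.add_apply]
        split_ifs
        · rfl
        · simp only [Matrix.mul_add, Matrix.add_mul, Matrix.sub_apply, Matrix.add_apply]; abel
      map_smul' := by
        intro r X
        refine Matrix.ext fun i j => ?_
        simp only [of_apply, Matrix.smul_apply, RingHom.id_apply]
        split_ifs
        · rfl
        · simp only [Matrix.mul_smul, Matrix.smul_mul, Matrix.sub_apply, Matrix.smul_apply,
            smul_sub] }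
  have hG : ∀ X i j, G X i j = if i = j then X i j else (A * X - M * X * diagonal d) i j :=
    fun _ _ _ => rfl
  have hoff : ∀ X, (∀ i j, i ≠ j → G X i j = 0) →
      ∀ i j, i ≠ j → (A * X) i j = (M * X * diagonal d) i j := by
    intro X h i j hij
    have := h i j hij
    rwa [hG, if_neg hij, Matrix.sub_apply, sub_eq_zero] at this
  have hinj : Function.Injective G := by
    rw [← LinearMap.ker_eq_bot, LinearMap.ker_eq_bot']
    intro X hX
    refine Matrix.ext fun i j => ?_
    by_contra hne
    refine (hA.le_of_sylvester hb hM hd (hoff X fun i j _ => by rw [hX]; rfl) hne).2 ?_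
    have : G X j j = 0 := by rw [hX]; rfl
    rwa [hG, if_pos rfl] at this
  obtain ⟨X, hX⟩ := LinearMap.surjective_of_injective hinj (diagonal c)
  have hXo := hoff X fun i j hij => by rw [hX, diagonal_apply_ne _ hij]
  have hXd : ∀ i, X i i = c i := fun i => by
    have : G X i i = c i := by rw [hX, diagonal_apply_eq]
    rwa [hG, if_pos rfl] at this
  have hXt : X.BlockTriangular b := fun i j hij => by
    by_contra hne
    exact absurd (hA.le_of_sylvester hb hM hd hXo hne).1 (not_le.mpr hij)
  refine ⟨X, hXt, hXd, ?_⟩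
  refine Matrix.ext fun i j => ?_
  by_cases hij : i = j
  · subst hij
    rw [mul_diagonal, hA.mul_apply_of_forall_eq_zero hb fun k hk => hXt hk,
      hM.mul_apply_of_forall_eq_zero hb fun k hk => hXt hk, hXd, hc]
  · exact hXo i j hij

theorem BlockTriangular.isUnit_of_diag_ne_zero (hb : b.Injective) (hA : A.BlockTriangular b)
    (h : ∀ i, A i i ≠ 0) : IsUnit A := by
  have hinj : Function.Injective (LinearMap.mulLeft ℝ A) := by
    rw [← LinearMap.ker_eq_bot, LinearMap.ker_eq_bot']
    intro X hX
    refine Matrix.ext fun i j => ?_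
    by_contra hne
    classical
    obtain ⟨k, hk, hmax⟩ := Finset.exists_max_image (Finset.univ.filter fun k => X k j ≠ 0) b
      ⟨i, by simpa using hne⟩
    simp only [Finset.mem_filter, Finset.mem_univ, true_and] at hk hmax
    have h1 := hA.mul_apply_of_forall_eq_zero hb (X := X) (i := k) (j := j) fun l hl => by
      by_contra hne
      exact absurd (hmax l hne) (not_le.mpr hl)
    rw [show A * X = 0 from hX] at h1
    exact mul_ne_zero (h k) hk h1.symm
  obtain ⟨X, hX⟩ := LinearMap.surjective_of_injective hinj 1
  have hAX : A * X = 1 := hX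
  exact IsUnit.of_mul_eq_one X hAX

end Sylvester

/-! ### Triangular matrices as commutators -/

/-- A unit matrix similar to a diagonal matrix with pure quaternion entries. -/
def IsPureDiagonalizable {ι : Type*} [Fintype ι] [DecidableEq ι] (X : (Matrix ι ι ℍ[ℝ])ˣ) : Prop :=
  ∃ (P : (Matrix ι ι ℍ[ℝ])ˣ) (d : ι → ℍ[ℝ]), (∀ i, (d i).re = 0) ∧
    (X : Matrix ι ι ℍ[ℝ]) = P * diagonal d * (P⁻¹ : (Matrix ι ι ℍ[ℝ])ˣ)

variable {ι : Type*} [Fintype ι] [DecidableEq ι]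

theorem IsPureDiagonalizable.conj {X : (Matrix ι ι ℍ[ℝ])ˣ} (hX : IsPureDiagonalizable X)
    (Q : (Matrix ι ι ℍ[ℝ])ˣ) : IsPureDiagonalizable (Q * X * Q⁻¹) := by
  obtain ⟨P, d, hd, h⟩ := hX
  exact ⟨Q * P, d, hd, by simp [h, mul_assoc]⟩

theorem IsPureDiagonalizable.mem_polyImage {X : (Matrix ι ι ℍ[ℝ])ˣ} (hX : IsPureDiagonalizable X)
    {p : FreeAlgebra ℝ ℕ} (hp : IsMultilinearPoly p) (h0 : polyImage p ℍ[ℝ] ≠ {0})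
    (hR : polyImage p ℍ[ℝ] ≠ Set.range (algebraMap ℝ ℍ[ℝ])) :
    (X : Matrix ι ι ℍ[ℝ]) ∈ polyImage p (Matrix ι ι ℍ[ℝ]) := by
  obtain ⟨P, d, hd, h⟩ := hX
  rw [h]
  exact conj_mem_polyImage P
    (diagonal_mem_polyImage fun i => hp.mem_polyImage_of_re_eq_zero h0 hR (hd i))

theorem BlockTriangular.isPureDiagonalizable {α : Type*} [LinearOrder α] {b : ι → α}
    (hb : b.Injective) {X : (Matrix ι ι ℍ[ℝ])ˣ} (hX : (X : Matrix ι ι ℍ[ℝ]).BlockTriangular b)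
    (hre : ∀ i, ((X : Matrix ι ι ℍ[ℝ]) i i).re = 0)
    (hn : Function.Injective fun i => ‖(X : Matrix ι ι ℍ[ℝ]) i i‖) : IsPureDiagonalizable X := by
  obtain ⟨P, hP, hP1, h⟩ := hX.exists_sylvester hb blockTriangular_one
    (d := fun i => (X : Matrix ι ι ℍ[ℝ]) i i)
    (fun i j hij => by simpa using hn.ne hij) (fun _ => 1) (by simp)
  obtain ⟨P, rfl⟩ := hP.isUnit_of_diag_ne_zero hb fun i => by rw [hP1]; exact one_ne_zero
  refine ⟨P, _, hre, ?_⟩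
  rw [Units.eq_mul_inv_iff_mul_eq, h, one_mul]

/-- A triangular matrix with unit quaternions on the diagonal is a commutator of matrices similar
to pure diagonal matrices. -/
theorem BlockTriangular.exists_commutator {α : Type*} [LinearOrder α] {b : ι → α}
    (hb : b.Injective) {M : (Matrix ι ι ℍ[ℝ])ˣ} (hM : (M : Matrix ι ι ℍ[ℝ]).BlockTriangular b)
    (hn : ∀ i, ‖(M : Matrix ι ι ℍ[ℝ]) i i‖ = 1) :
    ∃ X Y : (Matrix ι ι ℍ[ℝ])ˣ, IsPureDiagonalizable X ∧ IsPureDiagonalizable Y ∧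
      M = X * Y * X⁻¹ * Y⁻¹ := by
  choose x y hx hy hxn hyn hxy using fun i => Quaternion.exists_pure_commutator (hn i)
  -- Real scaling of `x i` and `y i` preserves their commutator and makes the diagonal norms
  -- distinct, as the Sylvester equations require.
  obtain ⟨s, hs, hs0⟩ : ∃ s : ι → ℝ, s.Injective ∧ ∀ i, 0 < s i := by
    let e := Fintype.equivFin ι
    refine ⟨fun i => ((e i : ℕ) : ℝ) + 1, fun i j h => ?_, fun i => by positivity⟩
    have h' : ((e i : ℕ) : ℝ) = (e j : ℕ) := add_right_cancel h
    exact e.injective (Fin.ext (Nat.cast_injective h'))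
  have hsn : ∀ (z : ι → ℍ[ℝ]), (∀ i, ‖z i‖ = 1) → ∀ i, ‖s i • z i‖ = s i := by
    intro z hz i
    rw [norm_smul, hz, mul_one, Real.norm_of_nonneg (hs0 i).le]
  have hs1 : ∀ (z : ι → ℍ[ℝ]), (∀ i, ‖z i‖ = 1) → ∀ i, s i • z i ≠ 0 := by
    intro z hz i
    rw [← norm_ne_zero_iff, hsn z hz]
    exact (hs0 i).ne'
  obtain ⟨D, hDx⟩ : ∃ D : Matrix ι ι ℍ[ℝ], D = diagonal fun i => s i • x i := ⟨_, rfl⟩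
  have hD : D.BlockTriangular b := hDx ▸ blockTriangular_diagonal _
  have hDi : ∀ i, D i i = s i • x i := fun i => by rw [hDx, diagonal_apply_eq]
  obtain ⟨X, hX⟩ := hD.isUnit_of_diag_ne_zero hb fun i => by
    rw [hDi]; exact hs1 x hxn i
  -- `D * Y = M * Y * D` is the identity `M = D * Y * D⁻¹ * Y⁻¹`.
  obtain ⟨Y, hY, hYd, hDY⟩ := hD.exists_sylvester hb hM (d := fun i => s i • x i)
    (fun i j hij => by
      rw [hDi, hn, one_mul, hsn x hxn, hsn x hxn]; exact hs.ne hij)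
    (fun i => s i • y i)
    (fun i => by
      rw [hDi, smul_mul_smul_comm, hxy, mul_assoc, smul_mul_smul_comm, mul_smul_comm])
  obtain ⟨Y, rfl⟩ := hY.isUnit_of_diag_ne_zero hb fun i => by rw [hYd]; exact hs1 y hyn i
  refine ⟨X, Y, ⟨1, fun i => s i • x i, fun i => ?_, by rw [hX, hDx]; simp⟩, hY.isPureDiagonalizable hb ?_ ?_, ?_⟩
  · rw [Quaternion.re_smul, hx, smul_zero]
  · intro i
    rw [hYd, Quaternion.re_smul, hy, smul_zero]
  · intro i j hij
    simp only [hYd, hsn y hyn] at hij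
    exact hs hij
  · rw [eq_mul_inv_iff_mul_eq, eq_mul_inv_iff_mul_eq]
    ext1
    simp only [Units.val_mul, hX]
    rw [← hDx] at hDY
    exact hDY.symm

end Matrix

/-! ### The real determinant and Schur complements -/

namespace Matrix

section RealDet

variable {ι κ : Type*} [Fintype ι] [DecidableEq ι] [Fintype κ] [DecidableEq κ]

/-- Multiplication of column vectors by a quaternionic matrix, as a real linear map. -/
def mulVecReal (A : Matrix ι ι ℍ[ℝ]) : (ι → ℍ[ℝ]) →ₗ[ℝ] (ι → ℍ[ℝ]) where
  toFun := A.mulVec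
  map_add' := A.mulVec_add
  map_smul' r v := A.mulVec_smul r v

/-- The determinant of a quaternionic matrix acting on a real vector space. -/
noncomputable def realDet : Matrix ι ι ℍ[ℝ] →* ℝ where
  toFun A := LinearMap.det A.mulVecReal
  map_one' := by
    have : (1 : Matrix ι ι ℍ[ℝ]).mulVecReal = LinearMap.id :=
      LinearMap.ext fun v => one_mulVec v
    rw [this, LinearMap.det_id]
  map_mul' A B := by
    have : (A * B).mulVecReal = A.mulVecReal.comp B.mulVecReal :=
      LinearMap.ext fun v => (mulVec_mulVec v A B).symm
    rw [this, LinearMap.det_comp]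

theorem realDet_apply (A : Matrix ι ι ℍ[ℝ]) : realDet A = LinearMap.det A.mulVecReal := rfl

theorem realDet_smul (r : ℝ) (A : Matrix ι ι ℍ[ℝ]) :
    realDet (r • A) = r ^ (4 * Fintype.card ι) * realDet A := by
  have : (r • A).mulVecReal = r • A.mulVecReal := LinearMap.ext fun v => smul_mulVec r A v
  have hf : Module.finrank ℝ (ι → ℍ[ℝ]) = 4 * Fintype.card ι := by
    rw [Module.finrank_pi_fintype]
    simp [Quaternion.finrank_eq_four, mul_comm]
  rw [realDet_apply, this, LinearMap.det_smul, hf, realDet_apply]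

theorem realDet_smul_one (r : ℝ) :
    realDet (r • (1 : Matrix ι ι ℍ[ℝ])) = r ^ (4 * Fintype.card ι) := by
  rw [realDet_smul, map_one, mul_one]

theorem realDet_submatrix_equiv (e : κ ≃ ι) (A : Matrix ι ι ℍ[ℝ]) :
    realDet (A.submatrix e e) = realDet A := by
  rw [realDet_apply, realDet_apply, ← LinearMap.det_conj A.mulVecReal
    (LinearEquiv.funCongrLeft ℝ ℍ[ℝ] e)]
  congr 1
  refine LinearMap.ext fun v => ?_
  exact submatrix_mulVec_equiv A v e e

theorem realDet_fromBlocks_zero (A : Matrix ι ι ℍ[ℝ]) (D : Matrix κ κ ℍ[ℝ]) :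
    realDet (fromBlocks A 0 0 D) = realDet A * realDet D := by
  simp only [realDet_apply]
  rw [← LinearMap.det_prodMap, ← LinearMap.det_conj (fromBlocks A 0 0 D).mulVecReal
    (LinearEquiv.sumArrowLequivProdArrow ι κ ℝ ℍ[ℝ])]
  congr 1
  refine LinearMap.ext fun v => ?_
  have h := fromBlocks_mulVec A 0 0 D (Sum.elim v.1 v.2)
  simp only [zero_mulVec, add_zero, zero_add, Sum.elim_comp_inl, Sum.elim_comp_inr] at h
  refine Prod.ext (funext fun i => ?_) (funext fun j => ?_)
  · exact congrFun h (Sum.inl i)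
  · exact congrFun h (Sum.inr j)

theorem realDet_ne_zero_of_mul_eq_one {A B : Matrix ι ι ℍ[ℝ]} (h : A * B = 1) : realDet A ≠ 0 :=
  left_ne_zero_of_mul (b := realDet B) (by rw [← map_mul, h, map_one]; exact one_ne_zero)

/-- For block unipotent `W`, conjugation by a block diagonal matrix with blocks 1 and 2 squares `W`,
so its determinant equals its own square. -/
theorem realDet_eq_one_of_mul_eq_sq_mul {W D : Matrix ι ι ℍ[ℝ]} (hW : realDet W ≠ 0)
    (hD : realDet D ≠ 0) (h : D * W = W * W * D) : realDet W = 1 := by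
  have := congrArg realDet h
  simp only [map_mul] at this
  refine mul_right_cancel₀ hW (mul_right_cancel₀ hD ?_)
  rw [one_mul, ← this, mul_comm]

theorem realDet_two_ne_zero : realDet (1 + 1 : Matrix ι ι ℍ[ℝ]) ≠ 0 := by
  rw [← two_smul ℝ (1 : Matrix ι ι ℍ[ℝ]), realDet_smul_one]
  positivity

theorem realDet_fromBlocks_one_zero₁₂ (C : Matrix κ ι ℍ[ℝ]) :
    realDet (fromBlocks (1 : Matrix ι ι ℍ[ℝ]) 0 C 1) = 1 := by
  refine realDet_eq_one_of_mul_eq_sq_mul (D := fromBlocks 1 0 0 (1 + 1))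
    (realDet_ne_zero_of_mul_eq_one (B := fromBlocks 1 0 (-C) 1) ?_) ?_ ?_
  · simp [fromBlocks_multiply]
  · rw [realDet_fromBlocks_zero, map_one, one_mul]; exact realDet_two_ne_zero
  · simp [fromBlocks_multiply, Matrix.add_mul]

theorem realDet_fromBlocks_one_zero₂₁ (R : Matrix ι κ ℍ[ℝ]) :
    realDet (fromBlocks (1 : Matrix ι ι ℍ[ℝ]) R 0 1) = 1 := by
  refine realDet_eq_one_of_mul_eq_sq_mul (D := fromBlocks (1 + 1) 0 0 1)
    (realDet_ne_zero_of_mul_eq_one (B := fromBlocks 1 (-R) 0 1) ?_) ?_ ?_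
  · simp [fromBlocks_multiply]
  · rw [realDet_fromBlocks_zero, map_one, mul_one]; exact realDet_two_ne_zero
  · simp [fromBlocks_multiply, Matrix.add_mul]

theorem realDet_fromBlocks_one₁₁ (R : Matrix ι κ ℍ[ℝ]) (C : Matrix κ ι ℍ[ℝ])
    (D : Matrix κ κ ℍ[ℝ]) : realDet (fromBlocks 1 R C D) = realDet (D - C * R) := by
  have : fromBlocks 1 R C D = fromBlocks 1 0 C 1 * fromBlocks 1 0 0 (D - C * R) *
      fromBlocks 1 R 0 1 := by
    simp [fromBlocks_multiply]
  rw [this, map_mul, map_mul, realDet_fromBlocks_one_zero₁₂, realDet_fromBlocks_one_zero₂₁,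
    realDet_fromBlocks_zero]
  simp

theorem realDet_fromBlocks₂₂ (A : Matrix ι ι ℍ[ℝ]) (R : Matrix ι κ ℍ[ℝ]) (C : Matrix κ ι ℍ[ℝ])
    {D K : Matrix κ κ ℍ[ℝ]} (hDK : D * K = 1) (hKD : K * D = 1) :
    realDet (fromBlocks A R C D) = realDet (A - R * K * C) * realDet D := by
  have : fromBlocks A R C D = fromBlocks 1 (R * K) 0 1 * fromBlocks (A - R * K * C) 0 0 D *
      fromBlocks 1 0 (K * C) 1 := by
    simp only [fromBlocks_multiply, Matrix.one_mul, Matrix.mul_one, Matrix.zero_mul,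
      Matrix.mul_zero, add_zero, zero_add]
    rw [Matrix.mul_assoc R K D, hKD, ← Matrix.mul_assoc D K C, hDK, Matrix.mul_one, Matrix.one_mul,
      Matrix.mul_assoc R K C, sub_add_cancel]
  rw [this, map_mul, map_mul, realDet_fromBlocks_one_zero₁₂, realDet_fromBlocks_one_zero₂₁,
    realDet_fromBlocks_zero]
  simp

theorem realDet_commutator (X Y : (Matrix ι ι ℍ[ℝ])ˣ) :
    realDet (X * Y * X⁻¹ * Y⁻¹ : (Matrix ι ι ℍ[ℝ])ˣ).val = 1 := by
  have h : ∀ Z : (Matrix ι ι ℍ[ℝ])ˣ, realDet Z.val * realDet (Z⁻¹).val = 1 := fun Z => by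
    rw [← map_mul, Units.mul_inv, map_one]
  simp only [Units.val_mul, map_mul]
  linear_combination (realDet Y.val * realDet (Y⁻¹).val) * h X + h Y

/-- The normalised entry is a commutator, so has determinant 1; thus `realDet B` is the fourth power
of the norm of the entry. -/
theorem norm_eq_one_of_abs_realDet [Unique ι] {B : Matrix ι ι ℍ[ℝ]} (hB : |realDet B| = 1) (i : ι) :
    ‖B i i‖ = 1 := by
  have hBd : B = diagonal fun i => B i i := by
    refine Matrix.ext fun i j => ?_
    rw [Subsingleton.elim i j, diagonal_apply_eq]
  have h0 : B i i ≠ 0 := by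
    intro h
    have : B = (0 : ℝ) • 1 := by
      refine Matrix.ext fun k j => ?_
      rw [Subsingleton.elim k i, Subsingleton.elim j i, h]; simp
    rw [this, realDet_smul_one, Fintype.card_unique] at hB
    norm_num at hB
  have hn : ‖B i i‖ ≠ 0 := norm_ne_zero_iff.mpr h0
  let U : Matrix ι ι ℍ[ℝ] := ‖B i i‖⁻¹ • B
  have hUi : ∀ k, ‖U k k‖ = 1 := by
    intro k
    rw [Subsingleton.elim k i]
    simp only [U, Matrix.smul_apply, norm_smul, norm_inv, norm_norm, inv_mul_cancel₀ hn]
  have hU : U.BlockTriangular (fun _ : ι => 0) := fun k j h => absurd h (lt_irrefl _)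
  have hb : Function.Injective (fun _ : ι => 0) := fun k j _ => Subsingleton.elim k j
  obtain ⟨V, hV⟩ := hU.isUnit_of_diag_ne_zero hb fun k => by
    rw [← norm_ne_zero_iff, hUi]; exact one_ne_zero
  rw [← hV] at hU hUi
  obtain ⟨X, Y, -, -, h⟩ := hU.exists_commutator hb hUi
  have hdet : realDet U = 1 := by rw [← hV, h, realDet_commutator]
  have hBU : B = ‖B i i‖ • U := by
    simp only [U, smul_smul, mul_inv_cancel₀ hn, one_smul]
  rw [hBU, realDet_smul, hdet, mul_one, Fintype.card_unique, abs_of_nonneg (by positivity)] at hB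
  exact (pow_eq_one_iff_of_nonneg (norm_nonneg _) (by norm_num)).mp hB

end RealDet

end Matrix

/-! ### Triangular factorisation up to similarity -/

namespace Matrix

section UnitLU

variable {ι κ : Type*} [Fintype ι] [DecidableEq ι] [Fintype κ] [DecidableEq κ]

/-- `B` is similar to a product of two triangular matrices, of opposite orientation for some
ordering of the indices, with diagonal entries of norm one. -/
def HasUnitLU (B : Matrix ι ι ℍ[ℝ]) : Prop :=
  ∃ (b : ι → ℕ) (P Q L U : Matrix ι ι ℍ[ℝ]), b.Injective ∧ P * Q = 1 ∧ Q * P = 1 ∧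
    L.BlockTriangular (OrderDual.toDual ∘ b) ∧ U.BlockTriangular b ∧
    (∀ i, ‖L i i‖ = 1) ∧ (∀ i, ‖U i i‖ = 1) ∧ B = P * (L * U) * Q

theorem HasUnitLU.of_conj {B S T : Matrix ι ι ℍ[ℝ]} (hST : S * T = 1) (hTS : T * S = 1)
    (h : HasUnitLU (S * B * T)) : HasUnitLU B := by
  obtain ⟨b, P, Q, L, U, hb, hPQ, hQP, hL, hU, hL1, hU1, h⟩ := h
  refine ⟨b, T * P, Q * S, L, U, hb, ?_, ?_, hL, hU, hL1, hU1, ?_⟩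
  · rw [show T * P * (Q * S) = T * (P * Q) * S by noncomm_ring, hPQ, mul_one, hTS]
  · rw [show Q * S * (T * P) = Q * (S * T) * P by noncomm_ring, hST, mul_one, hQP]
  · rw [show T * P * (L * U) * (Q * S) = T * (P * (L * U) * Q) * S by noncomm_ring, ← h,
      show T * (S * B * T) * S = (T * S) * B * (T * S) by noncomm_ring, hTS, one_mul, mul_one]

theorem HasUnitLU.of_submatrix (e : κ ≃ ι) {B : Matrix ι ι ℍ[ℝ]}
    (h : HasUnitLU (B.submatrix e e)) : HasUnitLU B := by
  obtain ⟨b, P, Q, L, U, hb, hPQ, hQP, hL, hU, hL1, hU1, h⟩ := h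
  refine ⟨b ∘ e.symm, P.submatrix e.symm e.symm, Q.submatrix e.symm e.symm,
    L.submatrix e.symm e.symm, U.submatrix e.symm e.symm, hb.comp e.symm.injective, ?_, ?_,
    hL.submatrix, hU.submatrix, fun i => hL1 _, fun i => hU1 _, ?_⟩
  · rw [submatrix_mul_equiv, hPQ, submatrix_one_equiv]
  · rw [submatrix_mul_equiv, hQP, submatrix_one_equiv]
  · rw [submatrix_mul_equiv, submatrix_mul_equiv, submatrix_mul_equiv, ← h, submatrix_submatrix]
    simp

theorem HasUnitLU.diagonal {d : ι → ℍ[ℝ]} (hd : ∀ i, ‖d i‖ = 1) : HasUnitLU (Matrix.diagonal d) := by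
  refine ⟨fun i => Fintype.equivFin ι i, 1, 1, Matrix.diagonal d, 1, fun i j h => ?_, one_mul 1,
    one_mul 1, blockTriangular_diagonal _, blockTriangular_one, fun i => ?_, fun i => ?_, ?_⟩
  · exact (Fintype.equivFin ι).injective (Fin.ext h)
  · rw [diagonal_apply_eq, hd]
  · rw [one_apply_eq, norm_one]
  · simp

/-- Gaussian elimination at a pivot 1. The similarity for the Schur complement turns the border into
`R * P` and `Q * C`; the pivot index is placed before all others. -/
theorem HasUnitLU.fromBlocks_one {R : Matrix Unit κ ℍ[ℝ]} {C : Matrix κ Unit ℍ[ℝ]}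
    {D : Matrix κ κ ℍ[ℝ]} (h : HasUnitLU (D - C * R)) : HasUnitLU (fromBlocks 1 R C D) := by
  obtain ⟨b, P, Q, L, U, hb, hPQ, hQP, hL, hU, hL1, hU1, h⟩ := h
  refine ⟨Sum.elim (fun _ => 0) (fun i => b i + 1), fromBlocks 1 0 0 P, fromBlocks 1 0 0 Q,
    fromBlocks 1 0 (Q * C) L, fromBlocks 1 (R * P) 0 U, ?_, ?_, ?_, ?_, ?_, ?_, ?_, ?_⟩
  · rintro (i | i) (j | j) hij
    · rfl
    · simp at hij
    · simp at hij
    · exact congrArg Sum.inr (hb (by simpa using hij))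
  · simp [fromBlocks_multiply, hPQ]
  · simp [fromBlocks_multiply, hQP]
  · rintro (i | i) (j | j) hij
    · simp at hij
    · rfl
    · exact absurd (show b i + 1 < 0 from hij) (Nat.not_lt_zero _)
    · exact hL (by simpa using hij)
  · rintro (i | i) (j | j) hij
    · simp at hij
    · simp at hij
    · rfl
    · exact hU (by simpa using hij)
  · rintro (i | i)
    · simp
    · exact hL1 i
  · rintro (i | i)
    · simp
    · exact hU1 i
  · simp only [fromBlocks_multiply, Matrix.one_mul, Matrix.mul_one, Matrix.zero_mul,
      Matrix.mul_zero, add_zero, zero_add]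
    rw [Matrix.mul_assoc R P Q, hPQ, Matrix.mul_one, ← Matrix.mul_assoc P Q C, hPQ,
      Matrix.one_mul, Matrix.mul_add, Matrix.add_mul, ← h, ← Matrix.mul_assoc P (Q * C) (R * P),
      ← Matrix.mul_assoc P Q C, hPQ, Matrix.one_mul, Matrix.mul_assoc C, Matrix.mul_assoc R P Q,
      hPQ, Matrix.mul_one, add_sub_cancel]

theorem exists_equiv_unit_sum {n : ℕ} (j : Fin (n + 1)) :
    ∃ e : Unit ⊕ Fin n ≃ Fin (n + 1), e (Sum.inl ()) = j := by
  let e₀ : Unit ⊕ Fin n ≃ Fin (n + 1) := Fintype.equivOfCardEq (by simp [add_comm])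
  exact ⟨e₀.trans (Equiv.swap (e₀ (Sum.inl ())) j), by simp⟩

theorem one_add_single_mul {i j : ι} (hij : i ≠ j) (c : ℍ[ℝ]) :
    (1 + single i j c) * (1 + single i j (-c)) = 1 := by
  rw [Matrix.mul_add, Matrix.mul_one, Matrix.add_mul, Matrix.one_mul,
    single_mul_single_of_ne _ _ _ _ hij.symm, add_zero, add_assoc, ← single_add]
  simp

theorem HasUnitLU.of_conj_single {B : Matrix ι ι ℍ[ℝ]} {i j : ι} (hij : i ≠ j) (c : ℍ[ℝ])
    (h : HasUnitLU ((1 + single i j c) * B * (1 + single i j (-c)))) : HasUnitLU B :=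
  h.of_conj (one_add_single_mul hij c) (by simpa using one_add_single_mul hij (-c))

theorem realDet_conj {B S T : Matrix ι ι ℍ[ℝ]} (hST : S * T = 1) :
    realDet (S * B * T) = realDet B := by
  have h : realDet S * realDet T = 1 := by rw [← map_mul, hST, map_one]
  rw [map_mul, map_mul]
  linear_combination realDet B * h

/-- A quaternion commuting with all quaternions is real. -/
theorem _root_.Quaternion.eq_re_smul_one_of_commute {q : ℍ[ℝ]} (h : ∀ c, c * q = q * c) :
    q = q.re • (1 : ℍ[ℝ]) := by
  have h1 := Quaternion.ext_iff.mp (h (Quaternion.unitOf (1, 0)))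
  have h2 := Quaternion.ext_iff.mp (h (Quaternion.unitOf (0, 1)))
  simp [Quaternion.re_unitOf, Quaternion.imI_unitOf, Quaternion.imJ_unitOf,
    Quaternion.imK_unitOf] at h1 h2
  ext <;> simp <;> linarith [h1.1, h1.2, h2.1, h2.2]

/-- Induction through the Schur complement, once conjugation has put a 1 on the diagonal. Only
diagonal matrices that resist this are left: a single entry or a real scalar matrix, where the
determinant fixes the norm. -/
theorem hasUnitLU_of_abs_realDet : ∀ (n : ℕ) (B : Matrix (Fin n) (Fin n) ℍ[ℝ]),
    |realDet B| = 1 → HasUnitLU B := by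
  intro n
  induction n with
  | zero =>
    intro B _
    have : B = Matrix.diagonal fun i => i.elim0 := Matrix.ext fun i => i.elim0
    rw [this]
    exact HasUnitLU.diagonal fun i => i.elim0
  | succ n ih =>
    have pivot : ∀ (B : Matrix (Fin (n + 1)) (Fin (n + 1)) ℍ[ℝ]) (j : Fin (n + 1)), B j j = 1 →
        |realDet B| = 1 → HasUnitLU B := by
      intro B j hj hB
      obtain ⟨e, he⟩ := exists_equiv_unit_sum j
      apply HasUnitLU.of_submatrix e
      rw [← realDet_submatrix_equiv e] at hB
      have h11 : (B.submatrix e e).toBlocks₁₁ = 1 := by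
        refine Matrix.ext fun a b => ?_
        rw [one_apply, if_pos (Subsingleton.elim a b)]
        simpa [toBlocks₁₁, he] using hj
      rw [← fromBlocks_toBlocks (B.submatrix e e), h11] at hB ⊢
      rw [realDet_fromBlocks_one₁₁] at hB
      exact HasUnitLU.fromBlocks_one (ih _ hB)
    have offdiag : ∀ (B : Matrix (Fin (n + 1)) (Fin (n + 1)) ℍ[ℝ]) (i j : Fin (n + 1)), i ≠ j →
        B i j ≠ 0 → |realDet B| = 1 → HasUnitLU B := by
      intro B i j hij h0 hB
      -- This multiple of row `i` added to row `j` makes entry `(j, j)` equal to 1; the right factor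
      -- alters only column `i`.
      refine HasUnitLU.of_conj_single hij.symm ((1 - B j j) * (B i j)⁻¹) (pivot _ j ?_ ?_)
      · rw [Matrix.mul_add, Matrix.mul_one, Matrix.add_apply, mul_single_apply_of_ne _ _ _ _ _ hij.symm,
          add_zero, Matrix.add_mul, Matrix.one_mul, Matrix.add_apply, single_mul_apply_same,
          inv_mul_cancel_right₀ h0, add_sub_cancel]
      · rwa [realDet_conj (one_add_single_mul hij.symm _)]
    intro B hB
    by_cases hoff : ∃ i j, i ≠ j ∧ B i j ≠ 0
    · obtain ⟨i, j, hij, h0⟩ := hoff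
      exact offdiag B i j hij h0 hB
    push Not at hoff
    have hBd : B = Matrix.diagonal fun i => B i i := by
      refine Matrix.ext fun i j => ?_
      by_cases hij : i = j
      · subst hij; rw [diagonal_apply_eq]
      · rw [hoff i j hij, diagonal_apply_ne _ hij]
    by_cases hcomm : ∃ (i j : Fin (n + 1)) (c : ℍ[ℝ]), i ≠ j ∧ c * B j j ≠ B i i * c
    · obtain ⟨i, j, c, hij, hc⟩ := hcomm
      -- The new entry `(i, j)` is `c * B j j - B i i * c`.
      refine HasUnitLU.of_conj_single hij c (offdiag _ i j hij ?_ ?_)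
      · rw [Matrix.mul_add, Matrix.mul_one, Matrix.add_apply, mul_single_apply_same,
          Matrix.add_mul, Matrix.one_mul, Matrix.add_apply, Matrix.add_apply,
          single_mul_apply_same, single_mul_apply_same, hoff i j hij, hoff j i hij.symm]
        intro H
        apply hc
        rw [zero_add, mul_zero, add_zero, mul_neg, add_neg_eq_zero] at H
        exact H
      · rwa [realDet_conj (one_add_single_mul hij _)]
    push Not at hcomm
    rw [hBd]
    apply HasUnitLU.diagonal
    rcases subsingleton_or_nontrivial (Fin (n + 1)) with hs | hs
    · let _ : Unique (Fin (n + 1)) := ⟨⟨0⟩, fun a => Subsingleton.elim a 0⟩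
      exact norm_eq_one_of_abs_realDet hB
    · have heq : ∀ i j, B i i = B j j := by
        intro i j
        by_cases hij : i = j
        · rw [hij]
        · simpa using (hcomm i j 1 hij).symm
      have hre : ∀ i, B i i = (B 0 0).re • (1 : ℍ[ℝ]) := by
        intro i
        rw [heq i 0]
        obtain ⟨k, hk⟩ := exists_ne (0 : Fin (n + 1))
        refine Quaternion.eq_re_smul_one_of_commute fun c => ?_
        have := hcomm 0 k c hk.symm
        rwa [heq k 0] at this
      have hBs : B = (B 0 0).re • 1 := by
        refine Matrix.ext fun i j => ?_
        by_cases hij : i = j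
        · subst hij; rw [hre i]; simp
        · rw [hoff i j hij, Matrix.smul_apply, one_apply_ne hij, smul_zero]
      rw [hBs, realDet_smul_one, abs_pow] at hB
      intro i
      rw [hre i, norm_smul, norm_one, mul_one, Real.norm_eq_abs]
      exact (pow_eq_one_iff_of_nonneg (abs_nonneg _) (by simp)).mp hB

theorem HasUnitLU.exists_commutators {B : Matrix ι ι ℍ[ℝ]} (h : HasUnitLU B) :
    ∃ X : Fin 4 → (Matrix ι ι ℍ[ℝ])ˣ, (∀ i, IsPureDiagonalizable (X i)) ∧
      B = ((X 0 * X 1 * (X 0)⁻¹ * (X 1)⁻¹) * (X 2 * X 3 * (X 2)⁻¹ * (X 3)⁻¹) :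
        (Matrix ι ι ℍ[ℝ])ˣ) := by
  obtain ⟨b, P, Q, L, U, hb, hPQ, hQP, hL, hU, hL1, hU1, rfl⟩ := h
  have hb' : Function.Injective (OrderDual.toDual ∘ b) := OrderDual.toDual.injective.comp hb
  have hne : ∀ M : Matrix ι ι ℍ[ℝ], (∀ i, ‖M i i‖ = 1) → ∀ i, M i i ≠ 0 := fun M hM i => by
    rw [← norm_ne_zero_iff, hM]; exact one_ne_zero
  obtain ⟨L, rfl⟩ := hL.isUnit_of_diag_ne_zero hb' (hne L hL1)
  obtain ⟨U, rfl⟩ := hU.isUnit_of_diag_ne_zero hb (hne U hU1)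
  obtain ⟨X, Y, hX, hY, rfl⟩ := hL.exists_commutator hb' hL1
  obtain ⟨Z, W, hZ, hW, rfl⟩ := hU.exists_commutator hb hU1
  let V : (Matrix ι ι ℍ[ℝ])ˣ := ⟨P, Q, hPQ, hQP⟩
  refine ⟨![V * X * V⁻¹, V * Y * V⁻¹, V * Z * V⁻¹, V * W * V⁻¹], fun i => ?_, ?_⟩
  · fin_cases i
    exacts [hX.conj V, hY.conj V, hZ.conj V, hW.conj V]
  · change ((V * ((X * Y * X⁻¹ * Y⁻¹) * (Z * W * Z⁻¹ * W⁻¹)) * V⁻¹ : (Matrix ι ι ℍ[ℝ])ˣ) :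
      Matrix ι ι ℍ[ℝ]) = ((V * X * V⁻¹) * (V * Y * V⁻¹) * (V * X * V⁻¹)⁻¹ * (V * Y * V⁻¹)⁻¹ *
        ((V * Z * V⁻¹) * (V * W * V⁻¹) * (V * Z * V⁻¹)⁻¹ * (V * W * V⁻¹)⁻¹) :
        (Matrix ι ι ℍ[ℝ])ˣ)
    congr 1
    group

end UnitLU

/-! ### Differences of matrices of determinant ±1 -/

section Difference

variable {κ : Type*} [Fintype κ] [DecidableEq κ]

/-- Left multiplication by `B` has finitely many real eigenvalues, so some negative number is not
among them. -/
theorem exists_pos_isUnit_smul_one_add (B : Matrix κ κ ℍ[ℝ]) :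
    ∃ t : ℝ, 0 < t ∧ IsUnit (t • 1 + B) := by
  let f : Module.End ℝ (Matrix κ κ ℍ[ℝ]) := LinearMap.mulLeft ℝ B
  have hfin := Module.End.finite_hasEigenvalue f
  obtain ⟨s, hs, hs'⟩ := ((Set.Iio_infinite (0 : ℝ)).sdiff hfin).nonempty
  refine ⟨-s, neg_pos.mpr hs, ?_⟩
  have hinj : Function.Injective (LinearMap.mulLeft ℝ (-s • 1 + B)) := by
    rw [← LinearMap.ker_eq_bot, LinearMap.ker_eq_bot']
    intro X hX
    by_contra hX0
    refine hs' (Module.End.hasEigenvalue_of_hasEigenvector (x := X)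
      ⟨Module.End.mem_eigenspace_iff.mpr ?_, hX0⟩)
    have hX' : (-s • 1 + B) * X = 0 := hX
    rw [Matrix.add_mul, neg_smul, Matrix.neg_mul, smul_mul_assoc, one_mul,
      neg_add_eq_zero] at hX'
    exact hX'.symm
  obtain ⟨X, hX⟩ := LinearMap.surjective_of_injective hinj 1
  have hAX : (-s • 1 + B) * X = 1 := hX
  exact IsUnit.of_mul_eq_one X hAX

theorem exists_mul_eq_of_ne_zero {w : Matrix κ Unit ℍ[ℝ]} (hw : w ≠ 0) (c : Matrix Unit Unit ℍ[ℝ]) :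
    ∃ f : Matrix Unit κ ℍ[ℝ], f * w = c := by
  obtain ⟨j, hj⟩ : ∃ j, w j () ≠ 0 := by
    by_contra! h
    exact hw (Matrix.ext fun j _ => h j)
  refine ⟨single () j (c () () * (w j ())⁻¹), Matrix.ext fun a b => ?_⟩
  rw [single_mul_apply_same, inv_mul_cancel_right₀ hj]

/-- Let `E` have lower right block `t` and Schur complement `y`, normalised to determinant 1.
Prescribing the Schur complement `x` of the sum is then a linear equation for the row `f`, solvable
if its coefficient column is nonzero. -/
theorem exists_realDet_eq_one_of_blocks (A : Matrix Unit Unit ℍ[ℝ]) (R : Matrix Unit κ ℍ[ℝ])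
    (C : Matrix κ Unit ℍ[ℝ]) (D : Matrix κ κ ℍ[ℝ]) (h : C ≠ 0 ∨ D ≠ 0) :
    ∃ E, |realDet E| = 1 ∧ |realDet (fromBlocks A R C D + E)| = 1 := by
  obtain ⟨t, ht, ⟨V, hV⟩⟩ := exists_pos_isUnit_smul_one_add D
  have hDK : (D + t • 1) * (V⁻¹).val = 1 := by rw [add_comm, ← hV, Units.mul_inv]
  have hKD : (V⁻¹).val * (D + t • 1) = 1 := by rw [add_comm, ← hV, Units.inv_mul]
  generalize (V⁻¹).val = K at hDK hKD
  have hδ := realDet_ne_zero_of_mul_eq_one hDK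
  obtain ⟨x, hx⟩ : ∃ x : ℝ, x ^ 4 = |realDet (D + t • 1)|⁻¹ :=
    ⟨_, Real.rpow_inv_natCast_pow (by positivity) (by norm_num : 4 ≠ 0)⟩
  -- Multiplied by `D + t • 1`, the coefficient column of `f` becomes `t⁻¹ • (D * s) - C`.
  obtain ⟨s, hs⟩ : ∃ s : Matrix κ Unit ℍ[ℝ], t⁻¹ • (D * s) ≠ C := by
    by_cases hC : C = 0
    · have hD : D ≠ 0 := h.resolve_left (not_not.mpr hC)
      obtain ⟨i, j, hij⟩ : ∃ i j, D i j ≠ 0 := by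
        by_contra! h
        exact hD (Matrix.ext h)
      refine ⟨single j () 1, fun H => hij ?_⟩
      have := congrFun (congrFun H i) ()
      rwa [hC, Matrix.smul_apply, mul_single_apply_same, mul_one, Matrix.zero_apply, smul_eq_zero,
        or_iff_right (inv_ne_zero ht.ne')] at this
    · exact ⟨0, by simpa using Ne.symm hC⟩
  have hw : t⁻¹ • s - K * (C + s) ≠ 0 := by
    intro H
    apply hs
    have h2 : (D + t • 1) * (t⁻¹ • s - K * (C + s)) = t⁻¹ • (D * s) - C := by
      rw [Matrix.mul_sub, ← Matrix.mul_assoc, hDK, Matrix.one_mul, Matrix.add_mul, Matrix.mul_smul,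
        Matrix.smul_mul, Matrix.one_mul, smul_smul, mul_inv_cancel₀ ht.ne', one_smul]
      abel
    rw [H, Matrix.mul_zero] at h2
    exact (sub_eq_zero.mp h2.symm)
  let y : ℝ := (t ^ Fintype.card κ)⁻¹
  obtain ⟨f, hf⟩ := exists_mul_eq_of_ne_zero hw (x • 1 - y • 1 - A + R * K * (C + s))
  refine ⟨fromBlocks (f * (t⁻¹ • (1 : Matrix κ κ ℍ[ℝ])) * s + y • 1) f s (t • 1), ?_, ?_⟩
  · rw [realDet_fromBlocks₂₂ (K := t⁻¹ • 1), add_sub_cancel_left, realDet_smul_one,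
      realDet_smul_one, Fintype.card_unit]
    · have : y ^ (4 * 1) * t ^ (4 * Fintype.card κ) = 1 := by
        simp only [y, mul_one, mul_comm 4 (Fintype.card κ), pow_mul]
        rw [← mul_pow, inv_mul_cancel₀ (pow_ne_zero _ ht.ne'), one_pow]
      rw [this, abs_one]
    · rw [smul_mul_smul_comm, mul_inv_cancel₀ ht.ne', one_smul, one_mul]
    · rw [smul_mul_smul_comm, inv_mul_cancel₀ ht.ne', one_smul, one_mul]
  · have hS : A + (f * (t⁻¹ • (1 : Matrix κ κ ℍ[ℝ])) * s + y • 1) - (R + f) * K * (C + s) = x • 1 := by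
      have hf2 : f * (t⁻¹ • s) - f * K * (C + s) =
          x • 1 - y • 1 - A + R * K * (C + s) := by
        rw [← hf, Matrix.mul_sub, Matrix.mul_assoc]
      rw [Matrix.mul_assoc f (t⁻¹ • (1 : Matrix κ κ ℍ[ℝ])) s, Matrix.smul_mul, Matrix.one_mul, Matrix.add_mul,
        Matrix.add_mul]
      rw [sub_eq_iff_eq_add] at hf2
      rw [hf2]
      abel
    rw [fromBlocks_add, realDet_fromBlocks₂₂ _ _ _ hDK hKD, hS, realDet_smul_one, Fintype.card_unit,
      mul_one, hx, abs_mul, abs_inv, abs_abs, inv_mul_cancel₀ (abs_ne_zero.mpr hδ)]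

/-- Every square quaternionic matrix of size at least two is a difference of two matrices of
determinant `±1`. -/
theorem exists_realDet_eq_one_add {n : ℕ} (hn : 2 ≤ n) (B : Matrix (Fin n) (Fin n) ℍ[ℝ]) :
    ∃ E, |realDet E| = 1 ∧ |realDet (B + E)| = 1 := by
  by_cases hB : B = 0
  · exact ⟨1, by simp, by simp [hB]⟩
  obtain ⟨i, k, hik⟩ : ∃ i k, B i k ≠ 0 := by
    by_contra! h
    exact hB (Matrix.ext h)
  obtain ⟨m, rfl⟩ : ∃ m, n = m + 1 := ⟨n - 1, by omega⟩
  have : Nontrivial (Fin (m + 1)) := Fin.nontrivial_iff_two_le.mpr hn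
  -- A pivot index other than `i` leaves the nonzero row `i` in the lower blocks; this needs size at
  -- least two.
  obtain ⟨j, hj⟩ := exists_ne i
  obtain ⟨e, he⟩ := exists_equiv_unit_sum j
  obtain ⟨E, hE, hE'⟩ := exists_realDet_eq_one_of_blocks (B.submatrix e e).toBlocks₁₁
    (B.submatrix e e).toBlocks₁₂ (B.submatrix e e).toBlocks₂₁ (B.submatrix e e).toBlocks₂₂ (by
      by_contra! h
      apply hik
      obtain ⟨a, rfl⟩ := e.surjective i
      obtain ⟨b, rfl⟩ := e.surjective k
      rcases a with a | a
      · exact absurd he.symm hj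
      · rcases b with b | b
        · exact congrFun (congrFun h.1 a) b
        · exact congrFun (congrFun h.2 a) b)
  rw [fromBlocks_toBlocks] at hE'
  refine ⟨E.submatrix e.symm e.symm, by rwa [realDet_submatrix_equiv], ?_⟩
  rw [← realDet_submatrix_equiv e, submatrix_add]
  simpa using hE'

end Difference

/-! ### Conclusion -/

theorem abs_realDet_of_mem_quatSL {n : ℕ} {B : QuatGL n} (hB : B ∈ QuatSL n) :
    |realDet (B : Matrix (Fin n) (Fin n) ℍ[ℝ])| = 1 := by
  have h := Abelianization.commutator_subset_ker
    (Units.map (realDet : Matrix (Fin n) (Fin n) ℍ[ℝ] →* ℝ)) hB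
  rw [MonoidHom.mem_ker] at h
  have h1 : realDet (B : Matrix (Fin n) (Fin n) ℍ[ℝ]) = 1 := congrArg Units.val h
  rw [h1, abs_one]

end Matrix

theorem theorem6p4 (n : ℕ) (hn : 2 ≤ n) :
    (∀ p : Fin 4 → FreeAlgebra ℝ ℕ,
      (∀ i, IsMultilinearPoly (p i)) →
      (∀ i, polyImage (p i) ℍ[ℝ] ≠ {0}) →
      (∀ i, polyImage (p i) ℍ[ℝ] ≠ Set.range (algebraMap ℝ ℍ[ℝ])) →
      ∀ B ∈ QuatSL n, ∃ A : Fin 4 → QuatGL n,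
        (∀ i, (A i : Matrix (Fin n) (Fin n) ℍ[ℝ]) ∈
          polyImage (p i) (Matrix (Fin n) (Fin n) ℍ[ℝ])) ∧
        B = (A 0 * A 1 * (A 0)⁻¹ * (A 1)⁻¹) * (A 2 * A 3 * (A 2)⁻¹ * (A 3)⁻¹)) ∧
    (∀ p : Fin 8 → FreeAlgebra ℝ ℕ,
      (∀ i, IsMultilinearPoly (p i)) →
      (∀ i, polyImage (p i) ℍ[ℝ] ≠ {0}) →
      (∀ i, polyImage (p i) ℍ[ℝ] ≠ Set.range (algebraMap ℝ ℍ[ℝ])) →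
      ∀ B : Matrix (Fin n) (Fin n) ℍ[ℝ], ∃ A : Fin 8 → QuatGL n,
        (∀ i, (A i : Matrix (Fin n) (Fin n) ℍ[ℝ]) ∈
          polyImage (p i) (Matrix (Fin n) (Fin n) ℍ[ℝ])) ∧
        B = (((A 0 * A 1 * (A 0)⁻¹ * (A 1)⁻¹) * (A 2 * A 3 * (A 2)⁻¹ * (A 3)⁻¹) : QuatGL n) :
              Matrix (Fin n) (Fin n) ℍ[ℝ]) -
            (((A 4 * A 5 * (A 4)⁻¹ * (A 5)⁻¹) * (A 6 * A 7 * (A 6)⁻¹ * (A 7)⁻¹) : QuatGL n) :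
              Matrix (Fin n) (Fin n) ℍ[ℝ])) := by

  refine ⟨fun p hp h0 hR B hB => ?_, fun p hp h0 hR B => ?_⟩
  · obtain ⟨X, hX, h⟩ :=
      (Matrix.hasUnitLU_of_abs_realDet n _ (Matrix.abs_realDet_of_mem_quatSL hB)).exists_commutators
    exact ⟨X, fun i => (hX i).mem_polyImage (hp i) (h0 i) (hR i), Units.ext h⟩
  · obtain ⟨E, hE, hBE⟩ := Matrix.exists_realDet_eq_one_add hn B
    obtain ⟨X, hX, h⟩ := (Matrix.hasUnitLU_of_abs_realDet n _ hBE).exists_commutators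
    obtain ⟨Y, hY, h'⟩ := (Matrix.hasUnitLU_of_abs_realDet n _ hE).exists_commutators
    have hZ : ∀ i, Matrix.IsPureDiagonalizable (Fin.append X Y i) := fun i =>
      Fin.addCases (motive := fun i => Matrix.IsPureDiagonalizable (Fin.append X Y i))
        (fun i => by rw [Fin.append_left]; exact hX i)
        (fun i => by rw [Fin.append_right]; exact hY i) i
    refine ⟨Fin.append X Y, fun i => (hZ i).mem_polyImage (hp i) (h0 i) (hR i), ?_⟩
    refine (add_sub_cancel_right B E).symm.trans ?_
    rw [h]
    nth_rw 1 [h']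
    rfl
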